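/- Let $\mathcal H=\mathbb C^2$, $\psi=(1,0)$, $N,M\in\mathbb N_0$, $\beta>0$, $\lambda=\tanh\beta$, and let $R_*\sigma=\lambda\sigma+(1-\lambda)\tfrac12\mathbb 1$ be the depolarizing channel on one-qubit states. For a linear map $T:\mathcal B(\mathcal H^{\otimes M})\to\mathcal B(\mathcal H^{\otimes N})$ with predual $T_*$, $\operatorname{tr}(T(X)\rho)=\operatorname{tr}(X\,T_*(\rho))$, the all-qubit fidelity is $$\mathcal F_{\rm all}(T)=\inf_{\sigma}\operatorname{tr}\bigl(\sigma^{\otimes M}\,T_*((R_*\sigma)^{\otimes N})\bigr),$$ the infimum being over all pure one-qubit states $\sigma$. Let $I[N]=\{s\in\tfrac12\mathbb N_0:\ s\le N/2,\ N/2-s\in\mathbb Z\}$, let $\mathcal H_s=\mathcal H_+^{\otimes 2s}$ be the symmetric subspace of $\mathcal H^{\otimes 2s}$ (carrying the spin-$s$ representation $\pi_s$ of $\mathrm{SU}(2)$), and let $\mathcal H^{\otimes N}=\bigoplus_{s\in I[N]}\mathcal H_s\otimes\mathcal K_{N,s}$, $U^{\otimes N}=\bigoplus_s\pi_s(U)\otimes\mathbb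 1$, be the isotypic decomposition under $\mathrm{SU}(2)$. With $S_k$ the projection onto the symmetric subspace of $\mathcal H^{\otimes k}$, let $\hat Q_{2s}:\mathcal B(\mathcal H^{\otimes M})\to\mathcal B(\mathcal H_s)$ be the optimal $2s\to M$ device: $\hat Q_{2s}(A)=S_{2s}(A\otimes\mathbb 1^{\otimes(2s-M)})S_{2s}$ for $M\le 2s$, and, for $M>2s$, the dual of $\hat Q_{2s*}(\theta)=\frac{2s+1}{M+1}S_M(\theta\otimes\mathbb 1^{\otimes(M-2s)})S_M$. The optimal purifier is $T^{\rm opt}(A)=\bigoplus_{s\in I[N]}\hat Q_{2s}(A)\otimes\mathbb 1_{\mathcal K_{N,s}}$. Let $L_3=\frac12\sum_k\sigma_3^{(k)}$, let $L_3^{(s)}$ be its restriction (for $2s$ qubits) to $\mathcal H_s$, and put $$\rho_s(\beta)=\frac{\sinh\beta}{\sinh((2s+1)\beta)}e^{2\beta L_3^{(s)}},\qquad w_N(s)=\frac{\sinh((2s+1)\beta)}{\sinh(\beta)\,(2\cosh\beta)^N}\dim\mathcal K_{N,s},$$ $$f_{\rm all}(M,\beta,s)=\operatorname{tr}\bigl[(|\psi\rangle\langle\psi|)^{\otimes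 M}\,\hat Q_{2s*}(\rho_s(\beta))\bigr].$$ **Proposition.** $$\mathcal F_{\rm all}(T^{\rm opt})=\sum_{s\in I[N]}w_N(s)\,f_{\rm all}(M,\beta,s),$$ and for every $s\in\frac12\mathbb N_0$ $$f_{\rm all}(M,\beta,s)=\begin{cases}\displaystyle\frac{2s+1}{M+1}\,\frac{1-e^{-2\beta}}{1-e^{-(4s+2)\beta}}&\text{if }M>2s\ (\text{cloning}),\\[3mm]\displaystyle\frac{1-e^{-2\beta}}{1-e^{-(4s+2)\beta}}\binom{2s}{M}^{-1}\sum_{K=0}^{2s}\binom KM e^{2\beta(K-2s)}&\text{if }M\le 2s\ (\text{partial trace}).\end{cases}$$ -/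

import Mathlib

open scoped Matrix

noncomputable section

namespace Purification

/-! ### Qubit registers -/

/-- Labels of the product basis of `N` qubits; label `0` stands for `(1,0)`, label `1` for `(0,1)`. -/
abbrev Cfg (N : ℕ) : Type := Fin N → Fin 2

/-- Operators on the `N`-qubit Hilbert space, written in the product basis. -/
abbrev Op (N : ℕ) : Type := Matrix (Cfg N) (Cfg N) ℂ

/-- The tensor power `A ⊗ ⋯ ⊗ A` of a one-qubit operator. -/
def tensorPow (N : ℕ) (A : Matrix (Fin 2) (Fin 2) ℂ) : Op N :=
  Matrix.of fun i j => ∏ k, A (i k) (j k)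

/-- The operator `A` acting on qubit number `k`, the identity acting on all others. -/
def onSite {N : ℕ} (k : Fin N) (A : Matrix (Fin 2) (Fin 2) ℂ) : Op N :=
  Matrix.of fun i j => if ∀ l, l ≠ k → i l = j l then A (i k) (j k) else 0

/-- `A ⊗ 1`, where `A` acts on the first `m` of `n` qubits and `1` on the last `n - m`. -/
def tensorOne {m n : ℕ} (h : m ≤ n) : Op m →ₗ[ℂ] Op n where
  toFun A := Matrix.of fun i j =>
    if ∀ k : Fin n, m ≤ (k : ℕ) → i k = j k then
      A (fun a => i (Fin.castLE h a)) (fun a => j (Fin.castLE h a))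
    else 0
  map_add' A B := by
    ext i j
    simp only [Matrix.of_apply, Matrix.add_apply]
    split_ifs <;> simp
  map_smul' c A := by
    ext i j
    simp only [Matrix.of_apply, Matrix.smul_apply, RingHom.id_apply]
    split_ifs <;> simp

/-- The unitary permuting the tensor factors:
`η (ψ₁ ⊗ ⋯ ⊗ ψ_N) = ψ_{η 1} ⊗ ⋯ ⊗ ψ_{η N}`. -/
def permOp {N : ℕ} (η : Equiv.Perm (Fin N)) : Op N :=
  Matrix.of fun i j => if i = (fun k => j (η k)) then 1 else 0

/-- The orthogonal projection onto the Bose (fully symmetric) subspace of `N` qubits. -/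
def bose (N : ℕ) : Op N :=
  ((Nat.factorial N : ℂ))⁻¹ • ∑ η : Equiv.Perm (Fin N), permOp η

/-- The trace dual of a linear map between operator spaces, determined by
`tr (traceDual Φ A * B) = tr (A * Φ B)`. It turns a Heisenberg picture map `T` into its predual
`T_*`, and a Schrödinger picture map into its Heisenberg dual. -/
def traceDual {m n : ℕ} (Φ : Op m →ₗ[ℂ] Op n) : Op n →ₗ[ℂ] Op m where
  toFun A := Matrix.of fun i j => (A * Φ (Matrix.single j i 1)).trace
  map_add' A B := by
    ext i j
    simp [Matrix.add_mul]
  map_smul' c A := by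
    ext i j
    simp

theorem trace_traceDual_mul {m n : ℕ} (Φ : Op m →ₗ[ℂ] Op n) (A : Op n) (B : Op m) :
    (traceDual Φ A * B).trace = (A * Φ B).trace := by
  have hB : B = ∑ i, ∑ j, B i j • Matrix.single i j (1 : ℂ) := by
    conv_lhs => rw [Matrix.matrix_eq_sum_single B]
    simp [Matrix.smul_single]
  conv_rhs => rw [hB]
  simp only [map_sum, map_smul, Matrix.mul_sum, Matrix.mul_smul, Matrix.trace_sum,
    Matrix.trace_smul, smul_eq_mul]
  simp only [Matrix.trace, Matrix.diag_apply, Matrix.mul_apply, traceDual, LinearMap.coe_mk,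
    AddHom.coe_mk, Matrix.of_apply]
  rw [Finset.sum_comm]
  refine Finset.sum_congr rfl fun i _ => Finset.sum_congr rfl fun j _ => ?_
  ring

/-- The expectation `tr (X ρ)` of an observable in a state. Both arguments are self-adjoint
wherever this is used, so the trace is real. -/
def expect {N : ℕ} (X ρ : Op N) : ℝ := ((X * ρ).trace).re

/-! ### Noise and the all-qubit fidelity -/

/-- The pure one-qubit states `|φ⟩⟨φ|`, where `φ` is a unit vector of `ℂ²`. -/
def pureStates : Set (Matrix (Fin 2) (Fin 2) ℂ) :=
  {σ | ∃ φ : Fin 2 → ℂ, star φ ⬝ᵥ φ = 1 ∧ σ = Matrix.vecMulVec φ (star φ)}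

/-- The depolarizing channel `R_* σ = r σ + (1 - r) 1/2` on density matrices. -/
def depolarize (r : ℝ) (σ : Matrix (Fin 2) (Fin 2) ℂ) : Matrix (Fin 2) (Fin 2) ℂ :=
  (r : ℂ) • σ + (((1 - r) / 2 : ℝ) : ℂ) • (1 : Matrix (Fin 2) (Fin 2) ℂ)

/-- The all-qubit fidelity of a device `T : B(H^{⊗M}) → B(H^{⊗N})` at noise parameter `r`:
the infimum over all pure `σ` of `tr (σ^{⊗M} T_* ((R_* σ)^{⊗N}))`. -/
def fidelityAll (r : ℝ) {N M : ℕ} (T : Op M →ₗ[ℂ] Op N) : ℝ :=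
  ⨅ σ : pureStates,
    expect (tensorPow M σ.1) (traceDual T (tensorPow N (depolarize r σ.1)))

/-! ### Decomposition of the tensor product representation of `SU(2)`

A spin `s` is recorded by the natural number `n = 2s`. The spin-`s` irreducible representation
is `U ↦ U^{⊗n}` on the Bose subspace of `n` qubits; an operator on that subspace is an `n`-qubit
operator `A` with `A = bose n * A * bose n`. -/

/-- Twice the spins that occur in `N` qubits: `n ≤ N` of the same parity as `N`. -/
def spins (N : ℕ) : Finset ℕ := {n ∈ Finset.range (N + 1) | n % 2 = N % 2}

/-- A linear map from `n` to `N` qubits, given by the vector of its matrix entries. -/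
def toMap {N n : ℕ} (v : EuclideanSpace ℂ (Cfg N × Cfg n)) : Matrix (Cfg N) (Cfg n) ℂ :=
  Matrix.of fun i j => v (i, j)

/-- The multiplicity space `K_{N,s}` of the spin `s = n/2` in `N` qubits: the intertwiners from the
spin-`s` representation to `U ↦ U^{⊗N}`, where a map defined on the Bose subspace is extended
by zero to its orthogonal complement. -/
def multSpace (N n : ℕ) : Submodule ℂ (EuclideanSpace ℂ (Cfg N × Cfg n)) where
  carrier := {v | toMap v * bose n = toMap v ∧
    ∀ U ∈ Matrix.specialUnitaryGroup (Fin 2) ℂ,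
      toMap v * tensorPow n U = tensorPow N U * toMap v}
  zero_mem' := by
    have h : toMap (0 : EuclideanSpace ℂ (Cfg N × Cfg n)) = 0 := by ext i j; simp [toMap]
    simp [h]
  add_mem' := by
    rintro a b ⟨ha, ha'⟩ ⟨hb, hb'⟩
    have h : toMap (a + b) = toMap a + toMap b := by ext i j; simp [toMap]
    refine ⟨by rw [h, Matrix.add_mul, ha, hb], fun U hU => ?_⟩
    rw [h, Matrix.add_mul, Matrix.mul_add, ha' U hU, hb' U hU]
  smul_mem' := by
    rintro c a ⟨ha, ha'⟩
    have h : toMap (c • a) = c • toMap a := by ext i j; simp [toMap]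
    refine ⟨by rw [h, Matrix.smul_mul, ha], fun U hU => ?_⟩
    rw [h, Matrix.smul_mul, Matrix.mul_smul, ha' U hU]

/-- `dim K_{N,s}` for `s = n/2`. -/
def multDim (N n : ℕ) : ℕ := Module.finrank ℂ (multSpace N n)

/-- The component `A ↦ A ⊗ 1` of the natural purifier for the spin `s = n/2`, in which
`H_s ⊗ K_{N,s}` is embedded into the `N`-qubit space by `x ⊗ V ↦ √(n+1) V x`. By Schur's lemma
`V* W = tr (V* W) / (n+1)` on the Bose subspace for all intertwiners `V`, `W`, so this embedding
is isometric for the Hilbert-Schmidt inner product on `K_{N,s}`. Hence, with an orthonormal basis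
`V_b` of `K_{N,s}`, the operator `A ⊗ 1` is `∑_b (√(n+1) V_b) A (√(n+1) V_b)*`, which does not
depend on the basis. -/
def natComponent (N n : ℕ) : Op n →ₗ[ℂ] Op N where
  toFun A := ((n : ℂ) + 1) • ∑ b,
    toMap (stdOrthonormalBasis ℂ (multSpace N n) b).1 * A *
      (toMap (stdOrthonormalBasis ℂ (multSpace N n) b).1)ᴴ
  map_add' A B := by
    simp [Matrix.mul_add, Matrix.add_mul, Finset.sum_add_distrib]
  map_smul' c A := by
    simp only [Matrix.mul_smul, Matrix.smul_mul, RingHom.id_apply]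
    rw [← Finset.smul_sum, smul_comm]

/-- The natural purifier `⊕_s A_s ↦ ⊕_s A_s ⊗ 1`. -/
def natPurifier (N : ℕ) : ((n : spins N) → Op n) →ₗ[ℂ] Op N :=
  ∑ n : spins N, natComponent N n ∘ₗ LinearMap.proj n

/-! ### Optimal cloning and the optimal purifier -/

/-- The optimal cloner from `n < M` to `M` qubits in the Schrödinger picture:
`θ ↦ (n+1)/(M+1) S_M (θ ⊗ 1) S_M` for `θ` on the Bose subspace of `n` qubits (a general `θ` is
first compressed to that subspace). -/
def clonerPredual {n M : ℕ} (h : n ≤ M) : Op n →ₗ[ℂ] Op M where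
  toFun θ := (((n : ℂ) + 1) / ((M : ℂ) + 1)) •
    (bose M * tensorOne h (bose n * θ * bose n) * bose M)
  map_add' A B := by
    simp [Matrix.mul_add, Matrix.add_mul]
  map_smul' c A := by
    simp only [Matrix.mul_smul, Matrix.smul_mul, RingHom.id_apply, map_smul]
    rw [smul_comm]

/-- Discarding `n - M` of `n ≥ M` qubits, in the Heisenberg picture: `A ↦ S_n (A ⊗ 1) S_n`. -/
def discard {n M : ℕ} (h : M ≤ n) : Op M →ₗ[ℂ] Op n where
  toFun A := bose n * tensorOne h A * bose n
  map_add' A B := by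
    simp [Matrix.mul_add, Matrix.add_mul]
  map_smul' c A := by
    simp

/-- The optimal device `Q̂_n` from `n` (symmetric) qubits to `M` qubits, in the Heisenberg
picture. -/
def cloner (M n : ℕ) : Op M →ₗ[ℂ] Op n :=
  if h : M ≤ n then discard h else traceDual (clonerPredual (Nat.le_of_not_le h))

/-- The optimal purifier `T^opt = T^nat ∘ Q̂`, with `Q̂ A = ⊕_s Q̂_{2s} A`. -/
def optPurifier (N M : ℕ) : Op M →ₗ[ℂ] Op N :=
  natPurifier N ∘ₗ LinearMap.pi fun n : spins N => cloner M n

/-! ### Weights and component fidelities -/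

/-- The 3-component of angular momentum of `N` qubits. -/
def L3 (N : ℕ) : Op N := ((1 : ℂ) / 2) • ∑ k : Fin N, onSite k !![1, 0; 0, -1]

/-- The spin-`s` state `ρ_s(β) = sinh β / sinh ((2s+1)β) · exp (2β L₃)` on the Bose subspace,
`n = 2s`. -/
def spinState (β : ℝ) (n : ℕ) : Op n :=
  ((Real.sinh β / Real.sinh ((n + 1) * β) : ℝ) : ℂ) •
    (bose n * NormedSpace.exp (((2 * β : ℝ) : ℂ) • L3 n) * bose n)

/-- `w_N(s) = sinh ((2s+1)β) / (sinh β (2 cosh β)^N) · dim K_{N,s}`, `n = 2s`. -/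
def weight (N : ℕ) (β : ℝ) (n : ℕ) : ℝ :=
  Real.sinh ((n + 1) * β) / (Real.sinh β * (2 * Real.cosh β) ^ N) * multDim N n

/-- `f_all(M,β,s) = tr (σ^{⊗M} Q̂_{2s*}(ρ_s(β)))`, where `σ` projects onto the vector `(1,0)` and
`n = 2s`. -/
def fAll (M : ℕ) (β : ℝ) (n : ℕ) : ℝ :=
  expect (tensorPow M !![1, 0; 0, 0]) (traceDual (cloner M n) (spinState β n))

end Purification

end

open Purification

/-!
In the product basis the Bose projection has the entries `bose i j = 1 / n.choose w` when `i` and `j`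
both contain `w` labels `1`, and `0` otherwise (`bose_apply`); the formulas for the component
fidelities are diagonal sums with these entries.

The fidelity formula rests on two facts about the intertwiners `V` spanning a multiplicity space.
First, `V` intertwines the torus of `SU(2)`, hence preserves weights, since `diag (e^i, e^{-i})`
has different eigenvalues on different weights (`mag_eq_of_intertwine`). Consequently `V` also
intertwines the complexified torus (`intertwine_torus`), to which the noisy state belongs:
`R_* σ = e^{2βL₃} / (2 cosh β)` for `σ` the first basis state (`depolarize_proj`). Second, by Schur's
lemma for the symmetric subspace (`eq_smul_bose_of_commute`), a normalized `V` satisfies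
`V* V = bose / (n + 1)` (`conjTranspose_mul_self_of_mem_multSpace`). Hence
`V* (e^{2βL₃})^{⊗N} V` is a multiple of the spin state, and summing over an orthonormal basis of
each multiplicity space gives `∑ w_N(s) f_all(s)` as the fidelity at the first basis state.

The optimal purifier is `SU(2)`-covariant (`trace_optPurifier_rotate`), and `SU(2)` acts transitively
on the pure states (`exists_rotate_eq`), so the quantity whose infimum defines the fidelity does
not depend on the pure state (`fidelityAll_optPurifier`).
-/

open scoped Matrix

noncomputable section

namespace Purification

/-! ### Tensor powers -/

theorem tensorPow_mul (N : ℕ) (A B : Matrix (Fin 2) (Fin 2) ℂ) :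
    tensorPow N (A * B) = tensorPow N A * tensorPow N B := by
  ext i j
  simp only [tensorPow, Matrix.of_apply, Matrix.mul_apply, Finset.prod_univ_sum,
    Fintype.piFinset_univ, Finset.prod_mul_distrib]

theorem tensorPow_one (N : ℕ) : tensorPow N 1 = 1 := by
  ext i j
  simp only [tensorPow, Matrix.of_apply, Matrix.one_apply, funext_iff]
  by_cases h : ∀ k, i k = j k
  · simp [h]
  · obtain ⟨k, hk⟩ := not_forall.1 h
    rw [if_neg h]
    exact Finset.prod_eq_zero (Finset.mem_univ k) (if_neg hk)

theorem tensorPow_conjTranspose (N : ℕ) (A : Matrix (Fin 2) (Fin 2) ℂ) :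
    tensorPow N Aᴴ = (tensorPow N A)ᴴ := by
  ext i j
  simp [tensorPow, Matrix.conjTranspose_apply]

theorem tensorPow_smul (N : ℕ) (c : ℂ) (A : Matrix (Fin 2) (Fin 2) ℂ) :
    tensorPow N (c • A) = c ^ N • tensorPow N A := by
  ext i j
  simp [tensorPow, Finset.prod_mul_distrib]

/-- The tensor power of the projection onto the first basis vector is the projection onto the
product vector with all labels `0`. -/
theorem tensorPow_proj (N : ℕ) : tensorPow N !![1, 0; 0, 0] = Matrix.single 0 0 1 := by
  have h : (!![1, 0; 0, 0] : Matrix (Fin 2) (Fin 2) ℂ) =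
      Matrix.of fun a b => if a = 0 ∧ b = 0 then 1 else 0 := by
    ext a b
    fin_cases a <;> fin_cases b <;> simp
  ext i j
  rw [h]
  simp only [tensorPow, Matrix.of_apply, Matrix.single_apply, Finset.prod_ite_zero,
    Finset.prod_const_one]
  congr 1
  simp only [Finset.mem_univ, true_imp_iff, forall_and, eq_comm (a := (0 : Cfg N)), funext_iff,
    Pi.zero_apply]

theorem tensorPow_unitary (N : ℕ) {U : Matrix (Fin 2) (Fin 2) ℂ}
    (hU : U ∈ Matrix.specialUnitaryGroup (Fin 2) ℂ) :
    tensorPow N U * (tensorPow N U)ᴴ = 1 ∧ (tensorPow N U)ᴴ * tensorPow N U = 1 := by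
  have h := (Matrix.mem_specialUnitaryGroup_iff.1 hU).1
  rw [← tensorPow_conjTranspose, ← tensorPow_mul, ← tensorPow_mul, ← tensorPow_one]
  exact ⟨congrArg _ (Matrix.mem_unitaryGroup_iff.1 h), congrArg _ (Matrix.mem_unitaryGroup_iff'.1 h)⟩

theorem conjTranspose_mem_specialUnitaryGroup {U : Matrix (Fin 2) (Fin 2) ℂ}
    (hU : U ∈ Matrix.specialUnitaryGroup (Fin 2) ℂ) :
    Uᴴ ∈ Matrix.specialUnitaryGroup (Fin 2) ℂ := by
  rw [Matrix.mem_specialUnitaryGroup_iff] at hU ⊢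
  refine ⟨?_, by rw [Matrix.det_conjTranspose, hU.2, star_one]⟩
  exact Unitary.star_mem hU.1

/-! ### Labels of a given weight -/

/-- The number of labels `1` in a configuration. -/
def ones {N : ℕ} (i : Cfg N) : ℕ := Finset.card {k | i k = 1}

/-- Twice the `L₃`-weight of a basis vector: the number of labels `0` minus the number of
labels `1`. -/
def mag {N : ℕ} (i : Cfg N) : ℤ := ∑ k, (1 - 2 * ((i k : ℕ) : ℤ))

theorem mag_eq {N : ℕ} (i : Cfg N) : mag i = N - 2 * ones i := by
  have h : ∑ k, ((i k : ℕ) : ℤ) = ones i := by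
    rw [ones, Finset.card_filter]
    push_cast
    refine Finset.sum_congr rfl fun k _ => ?_
    generalize i k = a
    fin_cases a <;> simp
  simp [mag, Finset.sum_sub_distrib, ← Finset.mul_sum, h]

theorem ones_le {N : ℕ} (i : Cfg N) : ones i ≤ N := by
  simpa [ones] using Finset.card_le_univ (Finset.univ.filter fun k => i k = 1)

theorem ones_zero {N : ℕ} : ones (0 : Cfg N) = 0 := by simp [ones]

theorem ones_eq_zero {N : ℕ} {i : Cfg N} : ones i = 0 ↔ i = 0 := by
  rw [ones, Finset.card_eq_zero, Finset.filter_eq_empty_iff, funext_iff]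
  refine ⟨fun h k => ?_, fun h k _ => by simp [h k]⟩
  have := h (Finset.mem_univ k)
  have h2 := (i k).isLt
  exact Fin.ext (by simp only [Fin.ext_iff] at this; simp at this ⊢; omega)

theorem ones_comp {N : ℕ} (i : Cfg N) (η : Equiv.Perm (Fin N)) :
    ones (fun k => i (η k)) = ones i := by
  refine Finset.card_bij (fun k _ => η k) (by simp) (fun a _ b _ h => η.injective h) fun b hb => ?_
  exact ⟨η.symm b, by simpa using hb, by simp⟩

theorem exists_perm_of_ones_eq {N : ℕ} {i j : Cfg N} (h : ones i = ones j) :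
    ∃ η : Equiv.Perm (Fin N), ∀ k, j (η k) = i k := by
  have h1 : ∀ c : Fin 2, Nonempty ({a // i a = c} ≃ {b // j b = c}) := by
    intro c
    rw [← Fintype.card_eq, Fintype.card_subtype, Fintype.card_subtype]
    have key : ∀ l : Cfg N, Finset.card {k | l k = 0} = N - ones l := by
      intro l
      have h0 : (Finset.univ.filter fun k => l k = 0) = (Finset.univ.filter fun k => l k = 1)ᶜ := by
        ext k
        simp only [Finset.mem_filter, Finset.mem_univ, true_and, Finset.mem_compl]
        generalize l k = a
        fin_cases a <;> simp
      rw [h0, Finset.card_compl, Fintype.card_fin, ones]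
    fin_cases c
    · exact (key i).trans ((congrArg _ h).trans (key j).symm)
    · exact h
  have e := fun c => (h1 c).some
  exact ⟨Equiv.ofFiberEquiv e, fun k => Equiv.ofFiberEquiv_map e k⟩

/-- There are `(#s).choose w` configurations of weight `w` whose labels `1` all lie in `s`. -/
theorem card_ones_eq {N : ℕ} (s : Finset (Fin N)) (w : ℕ) :
    Finset.card {i : Cfg N | ones i = w ∧ ∀ k ∉ s, i k = 0} = s.card.choose w := by
  rw [← Finset.card_powersetCard]
  refine Finset.card_bij (fun i _ => Finset.univ.filter fun k => i k = 1) ?_ ?_ ?_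
  · intro i hi
    simp only [Finset.mem_filter, Finset.mem_univ, true_and] at hi
    refine Finset.mem_powersetCard.2 ⟨fun k hk => ?_, hi.1⟩
    by_contra hks
    simp [hi.2 k hks] at hk
  · intro i _ j _ hij
    ext k
    have := Finset.ext_iff.1 hij k
    simp only [Finset.mem_filter, Finset.mem_univ, true_and] at this
    revert this
    generalize i k = a
    generalize j k = b
    fin_cases a <;> fin_cases b <;> simp
  · intro t ht
    have ht := Finset.mem_powersetCard.1 ht
    refine ⟨fun k => if k ∈ t then 1 else 0, ?_, ?_⟩
    · simp only [Finset.mem_filter, Finset.mem_univ, true_and]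
      refine ⟨?_, fun k hk => if_neg fun h => hk (ht.1 h)⟩
      simp [ones, ht.2]
    · ext k
      simp

theorem card_ones (N w : ℕ) : Finset.card {i : Cfg N | ones i = w} = N.choose w := by
  simpa using card_ones_eq (Finset.univ : Finset (Fin N)) w

theorem choose_ones_ne_zero {N : ℕ} (i : Cfg N) : ((N.choose (ones i) : ℕ) : ℂ) ≠ 0 :=
  Nat.cast_ne_zero.2 (Nat.choose_pos (ones_le i)).ne'

/-! ### The Bose projection -/

theorem permOp_mul_apply {N : ℕ} (η : Equiv.Perm (Fin N)) (X : Op N) (i j : Cfg N) :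
    (permOp η * X) i j = X (fun k => i (η.symm k)) j := by
  rw [Matrix.mul_apply, Finset.sum_eq_single fun k => i (η.symm k)]
  · simp [permOp]
  · intro l _ hl
    have : i ≠ fun k => l (η k) := by
      rintro rfl
      exact hl (by simp)
    simp [permOp, this]
  · simp

theorem mul_permOp_apply {N : ℕ} (η : Equiv.Perm (Fin N)) (X : Op N) (i j : Cfg N) :
    (X * permOp η) i j = X i fun k => j (η k) := by
  rw [Matrix.mul_apply, Finset.sum_eq_single fun k => j (η k)]
  · simp [permOp]
  · intro l _ hl
    simp [permOp, hl]
  · simp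

theorem bose_mul_tensorPow (N : ℕ) (A : Matrix (Fin 2) (Fin 2) ℂ) :
    bose N * tensorPow N A = tensorPow N A * bose N := by
  simp only [bose, Matrix.smul_mul, Matrix.mul_smul, Finset.sum_mul, Finset.mul_sum]
  congr 1
  refine Finset.sum_congr rfl fun η _ => ?_
  ext i j
  rw [permOp_mul_apply, mul_permOp_apply]
  simp only [tensorPow, Matrix.of_apply]
  rw [← Equiv.prod_comp η]
  simp

theorem bose_comp_left {N : ℕ} (ζ : Equiv.Perm (Fin N)) (i j : Cfg N) :
    bose N (fun k => i (ζ k)) j = bose N i j := by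
  simp only [bose, Matrix.smul_apply, Matrix.sum_apply, permOp, Matrix.of_apply]
  congr 1
  rw [← Equiv.sum_comp (Equiv.mulRight ζ)]
  refine Finset.sum_congr rfl fun η _ => ?_
  congr 1
  rw [eq_iff_iff, funext_iff, funext_iff]
  simp only [Equiv.coe_mulRight, Equiv.Perm.mul_apply]
  exact ⟨fun h k => by simpa using h (ζ.symm k), fun h k => h (ζ k)⟩

theorem bose_apply_eq_zero {N : ℕ} {i j : Cfg N} (h : ones i ≠ ones j) : bose N i j = 0 := by
  simp only [bose, Matrix.smul_apply, Matrix.sum_apply, permOp, Matrix.of_apply]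
  rw [Finset.sum_eq_zero, smul_zero]
  intro η _
  refine if_neg fun hij => h ?_
  rw [hij, ones_comp]

theorem sum_bose (N : ℕ) (j : Cfg N) : ∑ i, bose N i j = 1 := by
  simp only [bose, Matrix.smul_apply, Matrix.sum_apply, permOp, Matrix.of_apply]
  rw [← Finset.smul_sum, Finset.sum_comm]
  simp [Fintype.card_perm, Nat.factorial_ne_zero]

/-- The Bose projection averages over the configurations of equal weight. -/
theorem bose_apply {N : ℕ} (i j : Cfg N) :
    bose N i j = if ones i = ones j then ((N.choose (ones j) : ℕ) : ℂ)⁻¹ else 0 := by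
  split_ifs with h
  · have h1 : ∑ l, bose N l j = (N.choose (ones j) : ℕ) * bose N i j := by
      rw [← card_ones N (ones j), ← nsmul_eq_mul, ← Finset.sum_const, Finset.sum_filter]
      refine Finset.sum_congr rfl fun l _ => ?_
      split_ifs with hl
      · obtain ⟨η, hη⟩ := exists_perm_of_ones_eq (hl.trans h.symm)
        rw [← bose_comp_left η i j, funext hη]
      · exact bose_apply_eq_zero hl
    rw [sum_bose] at h1
    exact eq_inv_of_mul_eq_one_right h1.symm
  · exact bose_apply_eq_zero h

theorem bose_mul_bose (N : ℕ) : bose N * bose N = bose N := by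
  ext i j
  have h : ∀ l, bose N i l * bose N l j =
      if ones l = ones j then ((N.choose (ones j) : ℕ) : ℂ)⁻¹ * bose N i j else 0 := by
    intro l
    by_cases hl : ones l = ones j
    · simp only [bose_apply, hl, if_true]
      rw [mul_comm]
    · rw [bose_apply_eq_zero hl, mul_zero, if_neg hl]
  simp only [Matrix.mul_apply, h]
  rw [← Finset.sum_filter, Finset.sum_const, card_ones, nsmul_eq_mul,
    mul_inv_cancel_left₀ (choose_ones_ne_zero j)]

theorem bose_conjTranspose (N : ℕ) : (bose N)ᴴ = bose N := by
  ext i j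
  simp only [Matrix.conjTranspose_apply, bose_apply]
  by_cases h : ones i = ones j
  · simp [h]
  · simp [h, Ne.symm h]

/-- A sum over configurations of a function of the weight, grouped by weight. -/
theorem sum_ones {N : ℕ} (f : ℕ → ℂ) (P : Cfg N → Prop) [DecidablePred P] :
    ∑ i : Cfg N, (if P i then f (ones i) else 0) =
      ∑ w ∈ Finset.range (N + 1), (Finset.card {i : Cfg N | ones i = w ∧ P i} : ℂ) * f w := by
  rw [← Finset.sum_filter, ← Finset.sum_fiberwise_of_maps_to (g := ones)
    (t := Finset.range (N + 1)) fun i _ => Finset.mem_range.2 (Nat.lt_succ_of_le (ones_le i))]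
  refine Finset.sum_congr rfl fun w _ => ?_
  rw [Finset.filter_filter, Finset.sum_congr rfl fun i hi => by
    rw [(Finset.mem_filter.1 hi).2.2], Finset.sum_const, nsmul_eq_mul]
  simp only [and_comm]

theorem trace_bose (N : ℕ) : (bose N).trace = N + 1 := by
  -- The `N.choose w` diagonal entries of weight `w` are all `(N.choose w)⁻¹`.
  have h := sum_ones (N := N) (fun w => ((N.choose w : ℕ) : ℂ)⁻¹) (fun _ => True)
  simp only [if_true, and_true, card_ones] at h
  simp only [Matrix.trace, Matrix.diag_apply, bose_apply, if_true, h]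
  rw [Finset.sum_congr rfl fun w hw => mul_inv_cancel₀ (Nat.cast_ne_zero.2
    (Nat.choose_pos (Nat.lt_succ_iff.1 (Finset.mem_range.1 hw))).ne')]
  simp

/-- The product vector with all labels `0` is fixed by the Bose projection. -/
theorem bose_mul_mul_bose_zero (N : ℕ) (X : Op N) : (bose N * X * bose N) 0 0 = X 0 0 := by
  have h1 : ∀ l : Cfg N, bose N 0 l = if l = 0 then 1 else 0 := by
    intro l
    rw [bose_apply, ones_zero]
    by_cases h : l = 0
    · simp [h, ones_zero]
    · rw [if_neg h, if_neg fun h' => h (ones_eq_zero.1 h'.symm)]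
  have h2 : ∀ l : Cfg N, bose N l 0 = if l = 0 then 1 else 0 := by
    intro l
    rw [← bose_conjTranspose, Matrix.conjTranspose_apply, h1]
    split_ifs <;> simp
  simp [Matrix.mul_apply, h1, h2]

/-! ### The maximal torus and Schur's lemma -/

/-- The complexified torus element `diag (e^c, e^{-c})`, which is `e^{2cL₃}` for one qubit. -/
def torus (c : ℂ) : Matrix (Fin 2) (Fin 2) ℂ := Matrix.diagonal ![Complex.exp c, Complex.exp (-c)]

theorem tensorPow_torus (N : ℕ) (c : ℂ) :
    tensorPow N (torus c) = Matrix.diagonal fun i => Complex.exp (c * mag i) := by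
  have h : torus c = Matrix.of fun a b : Fin 2 =>
      if a = b then Complex.exp (c * ((1 - 2 * ((a : ℕ) : ℤ) : ℤ) : ℂ)) else 0 := by
    ext a b
    fin_cases a <;> fin_cases b <;> simp [torus]
    norm_num
  ext i j
  rw [h]
  simp only [tensorPow, Matrix.of_apply, Finset.prod_ite_zero, Matrix.diagonal_apply,
    ← Complex.exp_sum, ← Finset.mul_sum, mag, Int.cast_sum, Finset.mem_univ, true_imp_iff,
    funext_iff]

theorem torus_I_mem : torus Complex.I ∈ Matrix.specialUnitaryGroup (Fin 2) ℂ := by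
  rw [Matrix.mem_specialUnitaryGroup_iff, Matrix.mem_unitaryGroup_iff]
  constructor
  · rw [torus, Matrix.star_eq_conjTranspose, Matrix.diagonal_conjTranspose,
      Matrix.diagonal_mul_diagonal, ← Matrix.diagonal_one]
    congr 1
    ext a
    fin_cases a <;> simp [← Complex.exp_conj, ← Complex.exp_add]
  · simp [torus, Matrix.det_diagonal, ← Complex.exp_add]

/-- The element `diag (e^{i}, e^{-i})` separates all weights, because `π` is irrational. -/
theorem exp_I_mul_int_injective {m n : ℤ}
    (h : Complex.exp (Complex.I * m) = Complex.exp (Complex.I * n)) : m = n := by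
  obtain ⟨k, hk⟩ := Complex.exp_eq_exp_iff_exists_int.1 h
  have h1 : (m : ℂ) = n + k * (2 * Real.pi) := by
    apply mul_left_cancel₀ Complex.I_ne_zero
    rw [hk]; ring
  have h2 : (m : ℝ) = n + k * (2 * Real.pi) := by exact_mod_cast h1
  by_cases hk0 : k = 0
  · simpa [hk0] using h2
  · exfalso
    refine irrational_pi ⟨((m - n : ℤ) : ℚ) / (2 * k), ?_⟩
    have : (k : ℝ) ≠ 0 := by exact_mod_cast hk0
    push_cast
    field_simp
    linarith

theorem mag_eq_of_intertwine {N n : ℕ} {V : Matrix (Cfg N) (Cfg n) ℂ}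
    (h : V * tensorPow n (torus Complex.I) = tensorPow N (torus Complex.I) * V)
    {i : Cfg N} {j : Cfg n} (hij : V i j ≠ 0) : mag i = mag j := by
  have := congrFun (congrFun h i) j
  rw [tensorPow_torus, tensorPow_torus, Matrix.mul_diagonal, Matrix.diagonal_mul, mul_comm] at this
  exact exp_I_mul_int_injective (mul_right_cancel₀ hij this).symm

/-- Intertwiners of the torus of `SU(2)` also intertwine its complexification. -/
theorem intertwine_torus {N n : ℕ} {V : Matrix (Cfg N) (Cfg n) ℂ}
    (h : V * tensorPow n (torus Complex.I) = tensorPow N (torus Complex.I) * V) (c : ℂ) :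
    V * tensorPow n (torus c) = tensorPow N (torus c) * V := by
  ext i j
  rw [tensorPow_torus, tensorPow_torus, Matrix.mul_diagonal, Matrix.diagonal_mul, mul_comm]
  by_cases hij : V i j = 0
  · simp [hij]
  · rw [mag_eq_of_intertwine h hij]

/-- A rotation whose first row has equal, nonzero entries. -/
def quarterTurn : Matrix (Fin 2) (Fin 2) ℂ :=
  (((√2)⁻¹ : ℝ) : ℂ) • !![1, 1; -1, 1]

theorem quarterTurn_mem : quarterTurn ∈ Matrix.specialUnitaryGroup (Fin 2) ℂ := by
  have h : (((√2)⁻¹ : ℝ) : ℂ) * (((√2)⁻¹ : ℝ) : ℂ) = 1 / 2 := by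
    rw [← Complex.ofReal_mul, ← mul_inv, Real.mul_self_sqrt (by norm_num)]
    norm_num
  rw [Matrix.mem_specialUnitaryGroup_iff, Matrix.mem_unitaryGroup_iff]
  constructor
  · rw [quarterTurn, star_smul, Matrix.smul_mul, Matrix.mul_smul, smul_smul, Complex.star_def,
      Complex.conj_ofReal, h]
    ext a b
    rw [Matrix.smul_apply, Matrix.mul_apply]
    fin_cases a <;> fin_cases b <;>
      simp [Matrix.star_apply, Fin.sum_univ_two] <;> norm_num
  · rw [quarterTurn, Matrix.det_smul, Fintype.card_fin, pow_two, h]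
    simp [Matrix.det_fin_two]
    norm_num

/-- Schur's lemma for the symmetric subspace. Commuting with the torus makes `X` preserve weights;
comparing the row of the highest weight in `X U = U X`, where all entries of that row of `U` are
equal, shows that all column sums of `X` equal `X 0 0`; averaging by the Bose projection then
determines `X`. -/
theorem eq_smul_bose_of_commute {n : ℕ} {X : Op n} (hX : bose n * X = X)
    (h : ∀ U ∈ Matrix.specialUnitaryGroup (Fin 2) ℂ,
      X * tensorPow n U = tensorPow n U * X) : X = X 0 0 • bose n := by
  have hz : ∀ i j, ones i ≠ ones j → X i j = 0 := by
    intro i j hij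
    by_contra h0
    have := mag_eq_of_intertwine (h _ torus_I_mem) h0
    rw [mag_eq, mag_eq] at this
    omega
  have hU : ∀ j, tensorPow n quarterTurn 0 j = (((√2)⁻¹ : ℝ) : ℂ) ^ n := by
    intro j
    have h1 : ∀ a : Fin 2, quarterTurn 0 a = (((√2)⁻¹ : ℝ) : ℂ) := by
      intro a
      fin_cases a <;> simp [quarterTurn]
    simp [tensorPow, h1]
  have hne : (((√2)⁻¹ : ℝ) : ℂ) ^ n ≠ 0 :=
    pow_ne_zero _ (Complex.ofReal_ne_zero.2 (inv_ne_zero (by positivity)))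
  have hsum : ∀ j, ∑ l, X l j = X 0 0 := by
    intro j
    have h1 := congrFun (congrFun (h _ quarterTurn_mem) 0) j
    rw [Matrix.mul_apply, Matrix.mul_apply, Finset.sum_eq_single 0, hU] at h1
    · simp only [hU] at h1
      rw [← Finset.mul_sum, mul_comm] at h1
      exact (mul_left_cancel₀ hne h1).symm
    · intro l _ hl
      rw [hz 0 l, zero_mul]
      rw [ones_zero]
      exact fun h' => hl (ones_eq_zero.1 h'.symm)
    · simp
  ext i j
  rw [Matrix.smul_apply, smul_eq_mul]
  by_cases hij : ones i = ones j
  · rw [← hsum j, Finset.sum_mul, ← congrFun (congrFun hX i) j, Matrix.mul_apply]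
    refine Finset.sum_congr rfl fun l _ => ?_
    by_cases hl : ones l = ones j
    · rw [bose_apply, bose_apply, if_pos (hij.trans hl.symm), if_pos hij, hl, mul_comm]
    · rw [hz l j hl, mul_zero, zero_mul]
  · rw [hz i j hij, bose_apply_eq_zero hij, mul_zero]

theorem trace_toMap {N n : ℕ} (v : EuclideanSpace ℂ (Cfg N × Cfg n)) :
    ((toMap v)ᴴ * toMap v).trace = (‖v‖ : ℂ) ^ 2 := by
  rw [← Complex.ofReal_pow, EuclideanSpace.norm_sq_eq, Fintype.sum_prod_type_right]
  simp only [Matrix.trace, Matrix.diag_apply, Matrix.mul_apply, Matrix.conjTranspose_apply, toMap,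
    Matrix.of_apply, Complex.ofReal_sum, Complex.ofReal_pow]
  refine Finset.sum_congr rfl fun j _ => Finset.sum_congr rfl fun i _ => ?_
  rw [Complex.star_def, mul_comm, Complex.mul_conj, Complex.normSq_eq_norm_sq, Complex.ofReal_pow]

/-- A normalized intertwiner is, up to the factor `1 / (n + 1)`, isometric on the symmetric
subspace. -/
theorem conjTranspose_mul_self_of_mem_multSpace {N n : ℕ}
    {v : EuclideanSpace ℂ (Cfg N × Cfg n)} (hv : v ∈ multSpace N n) (h1 : ‖v‖ = 1) :
    (toMap v)ᴴ * toMap v = ((n : ℂ) + 1)⁻¹ • bose n := by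
  obtain ⟨hb, hU⟩ := hv
  set X := (toMap v)ᴴ * toMap v with hX
  have hs : X = X 0 0 • bose n := by
    refine eq_smul_bose_of_commute ?_ fun U hU' => ?_
    · rw [hX, ← Matrix.mul_assoc]
      nth_rewrite 1 [← bose_conjTranspose]
      rw [← Matrix.conjTranspose_mul, hb]
    · have h2 := congrArg Matrix.conjTranspose
        (hU _ (conjTranspose_mem_specialUnitaryGroup hU'))
      rw [Matrix.conjTranspose_mul, Matrix.conjTranspose_mul, tensorPow_conjTranspose,
        tensorPow_conjTranspose, Matrix.conjTranspose_conjTranspose,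
        Matrix.conjTranspose_conjTranspose] at h2
      rw [hX, Matrix.mul_assoc, hU U hU', ← Matrix.mul_assoc, ← h2, Matrix.mul_assoc]
  have ht : X.trace = 1 := by rw [hX, trace_toMap, h1]; simp
  rw [hs, Matrix.trace_smul, trace_bose, smul_eq_mul] at ht
  rw [hs, eq_inv_of_mul_eq_one_left ht]

/-! ### Covariance -/

/-- Rotation of an `N`-qubit operator by the one-qubit operator `U`. -/
def rotate (N : ℕ) (U : Matrix (Fin 2) (Fin 2) ℂ) (X : Op N) : Op N :=
  tensorPow N U * X * (tensorPow N U)ᴴ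

theorem tensorPow_rotate (N : ℕ) (U A : Matrix (Fin 2) (Fin 2) ℂ) :
    tensorPow N (U * A * Uᴴ) = rotate N U (tensorPow N A) := by
  rw [rotate, tensorPow_mul, tensorPow_mul, tensorPow_conjTranspose]

theorem trace_rotate_mul_rotate {N : ℕ} {U : Matrix (Fin 2) (Fin 2) ℂ}
    (hU : U ∈ Matrix.specialUnitaryGroup (Fin 2) ℂ) (X Y : Op N) :
    (rotate N U X * rotate N U Y).trace = (X * Y).trace := by
  have h : rotate N U X * rotate N U Y = tensorPow N U * (X * Y * (tensorPow N U)ᴴ) := by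
    simp only [rotate, Matrix.mul_assoc]
    rw [← Matrix.mul_assoc (tensorPow N U)ᴴ (tensorPow N U), (tensorPow_unitary N hU).2,
      Matrix.one_mul]
  rw [h, Matrix.trace_mul_comm, Matrix.mul_assoc, (tensorPow_unitary N hU).2, Matrix.mul_one]

theorem bose_mul_rotate_mul_bose {N : ℕ} (U : Matrix (Fin 2) (Fin 2) ℂ) (X : Op N) :
    bose N * rotate N U X * bose N = rotate N U (bose N * X * bose N) := by
  have h := bose_mul_tensorPow N U
  have h' := bose_mul_tensorPow N Uᴴ
  rw [tensorPow_conjTranspose] at h'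
  simp only [rotate, ← Matrix.mul_assoc]
  rw [h]
  simp only [Matrix.mul_assoc]
  rw [h']

/-- Tensoring with the identity is covariant: after splitting the register into its first `m`
and last `d` qubits, both operators become Kronecker products. -/
theorem tensorOne_rotate {m n : ℕ} (h : m ≤ n) {U : Matrix (Fin 2) (Fin 2) ℂ}
    (hU : U ∈ Matrix.specialUnitaryGroup (Fin 2) ℂ) (A : Op m) :
    tensorOne h (rotate m U A) = rotate n U (tensorOne h A) := by
  obtain ⟨d, rfl⟩ := Nat.exists_eq_add_of_le h
  let e : Cfg m × Cfg d ≃ Cfg (m + d) := Fin.appendEquiv m d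
  have he : ∀ p, e p = Fin.append p.1 p.2 := fun _ => rfl
  have h1 : ∀ B : Op m, (tensorOne h B).submatrix e e = Matrix.kroneckerMap (· * ·) B (1 : Op d) := by
    intro B
    ext ⟨a, b⟩ ⟨a', b'⟩
    have hcast : ∀ k : Fin m, Fin.castLE h k = Fin.castAdd d k := fun _ => rfl
    have hc : (∀ k : Fin (m + d), m ≤ (k : ℕ) → Fin.append a b k = Fin.append a' b' k) ↔ b = b' := by
      rw [funext_iff]
      refine ⟨fun hk l => by simpa using hk (Fin.natAdd m l) (by simp), fun hl k hk => ?_⟩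
      induction k using Fin.addCases with
      | left k => exact absurd k.isLt (not_lt.2 (by simpa using hk))
      | right k => simp [hl k]
    simp only [Matrix.submatrix_apply, he, tensorOne, LinearMap.coe_mk, AddHom.coe_mk,
      Matrix.of_apply, hc, hcast, Fin.append_left, Matrix.kroneckerMap_apply, Matrix.one_apply,
      mul_ite, mul_one, mul_zero]
  have h2 : ∀ B, (tensorPow (m + d) B).submatrix e e =
      Matrix.kroneckerMap (· * ·) (tensorPow m B) (tensorPow d B) := by
    intro B
    ext ⟨a, b⟩ ⟨a', b'⟩
    simp [he, tensorPow, Fin.prod_univ_add]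
  -- It suffices to compare the operators after splitting the register.
  apply_fun fun X : Op (m + d) => X.submatrix e e using
    fun X Y hXY => by
      ext i j
      simpa using congrFun (congrFun hXY (e.symm i)) (e.symm j)
  simp only [rotate, h1]
  rw [← tensorPow_conjTranspose, ← tensorPow_conjTranspose, ← Matrix.submatrix_mul_equiv _ _ e e e,
    ← Matrix.submatrix_mul_equiv _ _ e e e, h1, h2, h2]
  rw [← Matrix.mul_kronecker_mul, ← Matrix.mul_kronecker_mul, Matrix.mul_one,
    tensorPow_conjTranspose d, (tensorPow_unitary d hU).1]

/-- The optimal device is covariant, stated in terms of its expectation values. -/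
theorem trace_cloner_rotate {M n : ℕ} {U : Matrix (Fin 2) (Fin 2) ℂ}
    (hU : U ∈ Matrix.specialUnitaryGroup (Fin 2) ℂ) (A : Op M) (X : Op n) :
    (cloner M n (rotate M U A) * rotate n U X).trace = (cloner M n A * X).trace := by
  rw [cloner]
  split_ifs with h
  · have : discard h (rotate M U A) = rotate n U (discard h A) := by
      simp only [discard, LinearMap.coe_mk, AddHom.coe_mk]
      rw [tensorOne_rotate h hU, bose_mul_rotate_mul_bose]
    rw [this, trace_rotate_mul_rotate hU]
  · have hle := Nat.le_of_not_le h
    have : clonerPredual hle (rotate n U X) = rotate M U (clonerPredual hle X) := by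
      simp only [clonerPredual, LinearMap.coe_mk, AddHom.coe_mk]
      rw [bose_mul_rotate_mul_bose, tensorOne_rotate hle hU, bose_mul_rotate_mul_bose]
      simp only [rotate, Matrix.mul_smul, Matrix.smul_mul]
    rw [trace_traceDual_mul, trace_traceDual_mul, this, trace_rotate_mul_rotate hU]

/-- The natural purifier turns expectations in an `N`-qubit state `ρ` into expectations in the
compressions of `ρ` by an orthonormal basis of intertwiners. -/
theorem trace_optPurifier_mul {N M : ℕ} (A : Op M) (ρ : Op N) :
    (optPurifier N M A * ρ).trace = ∑ n ∈ spins N, ((n : ℂ) + 1) *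
      ∑ b, (cloner M n A * ((toMap (stdOrthonormalBasis ℂ (multSpace N n) b).1)ᴴ * ρ *
        toMap (stdOrthonormalBasis ℂ (multSpace N n) b).1)).trace := by
  rw [← Finset.sum_coe_sort (spins N)]
  simp only [optPurifier, natPurifier, natComponent, LinearMap.comp_apply, LinearMap.sum_apply,
    LinearMap.pi_apply, LinearMap.proj_apply, LinearMap.coe_mk, AddHom.coe_mk, Finset.sum_mul,
    Matrix.trace_sum, Matrix.smul_mul, Matrix.trace_smul, smul_eq_mul]
  refine Finset.sum_congr rfl fun n _ => congrArg _ (Finset.sum_congr rfl fun b _ => ?_)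
  rw [Matrix.mul_assoc, Matrix.mul_assoc, Matrix.trace_mul_comm, Matrix.mul_assoc]

theorem trace_optPurifier_rotate {N M : ℕ} {U : Matrix (Fin 2) (Fin 2) ℂ}
    (hU : U ∈ Matrix.specialUnitaryGroup (Fin 2) ℂ) (A : Op M) (ρ : Op N) :
    (optPurifier N M (rotate M U A) * rotate N U ρ).trace = (optPurifier N M A * ρ).trace := by
  rw [trace_optPurifier_mul, trace_optPurifier_mul]
  refine Finset.sum_congr rfl fun n _ => congrArg _ (Finset.sum_congr rfl fun b _ => ?_)
  refine Eq.trans ?_ (trace_cloner_rotate hU _ _)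
  congr 2
  set V := toMap (stdOrthonormalBasis ℂ (multSpace N n) b).1
  -- The adjoint of an intertwiner intertwines, because `Uᴴ` is again in `SU(2)`.
  have h3 : Vᴴ * tensorPow N U = tensorPow n U * Vᴴ := by
    have h4 := (stdOrthonormalBasis ℂ (multSpace N n) b).2.2 _
      (conjTranspose_mem_specialUnitaryGroup hU)
    have := congrArg Matrix.conjTranspose h4
    simpa [Matrix.conjTranspose_mul, tensorPow_conjTranspose] using this.symm
  have h5 : (tensorPow N U)ᴴ * V = V * (tensorPow n U)ᴴ := by
    have := congrArg Matrix.conjTranspose h3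
    simpa [Matrix.conjTranspose_mul] using this
  simp only [rotate, ← Matrix.mul_assoc]
  rw [h3]
  simp only [Matrix.mul_assoc]
  rw [h5]

/-- `SU(2)` acts transitively on the pure states. -/
theorem exists_rotate_eq {σ : Matrix (Fin 2) (Fin 2) ℂ} (hσ : σ ∈ pureStates) :
    ∃ U ∈ Matrix.specialUnitaryGroup (Fin 2) ℂ, σ = U * !![1, 0; 0, 0] * Uᴴ := by
  obtain ⟨φ, hφ, rfl⟩ := hσ
  simp only [dotProduct, Fin.sum_univ_two, Pi.star_apply] at hφ
  refine ⟨!![φ 0, -star (φ 1); φ 1, star (φ 0)], ?_, ?_⟩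
  · rw [Matrix.mem_specialUnitaryGroup_iff, Matrix.mem_unitaryGroup_iff']
    constructor
    · ext a b
      fin_cases a <;> fin_cases b <;>
        simp [Matrix.mul_apply, Matrix.star_apply, Fin.sum_univ_two] at hφ ⊢ <;>
        first | linear_combination hφ | ring
    · rw [Matrix.det_fin_two_of]
      linear_combination hφ
  · ext a b
    fin_cases a <;> fin_cases b <;>
      simp [Matrix.mul_apply, Matrix.vecMulVec_apply, Fin.sum_univ_two]

theorem depolarize_rotate (r : ℝ) {U : Matrix (Fin 2) (Fin 2) ℂ}
    (hU : U ∈ Matrix.specialUnitaryGroup (Fin 2) ℂ) (σ : Matrix (Fin 2) (Fin 2) ℂ) :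
    depolarize r (U * σ * Uᴴ) = U * depolarize r σ * Uᴴ := by
  have h : U * Uᴴ = 1 :=
    Matrix.mem_unitaryGroup_iff.1 (Matrix.mem_specialUnitaryGroup_iff.1 hU).1
  simp only [depolarize, Matrix.mul_add, Matrix.add_mul, Matrix.mul_smul, Matrix.smul_mul,
    Matrix.mul_one, h]

theorem expect_traceDual {N M : ℕ} (T : Op M →ₗ[ℂ] Op N) (A : Op M) (ρ : Op N) :
    expect A (traceDual T ρ) = ((T A * ρ).trace).re := by
  rw [expect, Matrix.trace_mul_comm, trace_traceDual_mul, Matrix.trace_mul_comm]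

/-- By covariance, the infimum over the pure states is attained at each of them. -/
theorem fidelityAll_optPurifier (N M : ℕ) (r : ℝ) :
    fidelityAll r (optPurifier N M) = ((optPurifier N M (tensorPow M !![1, 0; 0, 0]) *
      tensorPow N (depolarize r !![1, 0; 0, 0])).trace).re := by
  have hne : Nonempty pureStates :=
    ⟨⟨_, Pi.single 0 1, by simp, rfl⟩⟩
  rw [fidelityAll, ← ciInf_const (ι := pureStates) (a := Complex.re _)]
  refine iInf_congr fun σ => ?_
  obtain ⟨U, hU, hσ⟩ := exists_rotate_eq σ.2
  rw [expect_traceDual, hσ, depolarize_rotate r hU, tensorPow_rotate, tensorPow_rotate,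
    trace_optPurifier_rotate hU]

/-! ### Evaluation of the fidelity -/

/-- The noisy basis state is a normalized element of the complexified torus. -/
theorem depolarize_proj (β : ℝ) :
    depolarize (Real.tanh β) !![1, 0; 0, 0] = ((2 * Real.cosh β : ℝ) : ℂ)⁻¹ • torus β := by
  have hc : (Real.cosh β : ℂ) ≠ 0 := Complex.ofReal_ne_zero.2 (Real.cosh_pos β).ne'
  have h1 : Complex.exp β = Real.cosh β + Real.sinh β := by
    rw [← Complex.ofReal_add, Real.cosh_add_sinh, Complex.ofReal_exp]
  have h2 : Complex.exp (-β) = Real.cosh β - Real.sinh β := by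
    rw [← Complex.ofReal_sub, Real.cosh_sub_sinh, ← Complex.ofReal_neg, Complex.ofReal_exp]
  ext a b
  rw [depolarize, torus, h1, h2, Real.tanh_eq_sinh_div_cosh]
  push_cast at hc ⊢
  fin_cases a <;> fin_cases b <;> simp <;> field_simp <;> ring_nf <;> simp

theorem exp_L3 (β : ℝ) (n : ℕ) :
    NormedSpace.exp (((2 * β : ℝ) : ℂ) • L3 n) = tensorPow n (torus β) := by
  have hk : ∀ k : Fin n, onSite k !![1, 0; 0, -1] =
      Matrix.diagonal fun i : Cfg n => ((1 - 2 * ((i k : ℕ) : ℤ) : ℤ) : ℂ) := by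
    intro k
    ext i j
    simp only [onSite, Matrix.of_apply, Matrix.diagonal_apply]
    by_cases hij : i = j
    · subst hij
      simp only [implies_true, if_true]
      generalize i k = a
      fin_cases a <;> simp
    · rw [if_neg hij]
      split_ifs with h
      · have hne : i k ≠ j k := fun h' => hij <| funext fun l => by
          by_cases hl : l = k
          · rw [hl, h']
          · exact h l hl
        revert hne
        generalize i k = a
        generalize j k = b
        fin_cases a <;> fin_cases b <;> simp
      · rfl
  have hL : ((2 * β : ℝ) : ℂ) • L3 n = Matrix.diagonal fun i => (β : ℂ) * mag i := by
    ext i j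
    simp only [L3, hk, Matrix.smul_apply, Matrix.sum_apply, Matrix.diagonal_apply, mag, smul_eq_mul]
    split_ifs
    · push_cast
      ring
    · simp
  rw [hL, Matrix.exp_diagonal, tensorPow_torus, Pi.exp_def]
  simp only [Complex.exp_eq_exp_ℂ]

/-- The normalization `sinh β / sinh ((n + 1) β)` of the spin state. -/
def spinNorm (β : ℝ) (n : ℕ) : ℝ := Real.sinh β / Real.sinh ((n + 1) * β)

theorem spinState_eq (β : ℝ) (n : ℕ) :
    spinState β n = (spinNorm β n : ℂ) • (bose n * tensorPow n (torus β)) := by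
  rw [spinState, exp_L3, Matrix.mul_assoc, ← bose_mul_tensorPow, ← Matrix.mul_assoc, bose_mul_bose,
    spinNorm]

theorem bose_mul_spinState_mul_bose (β : ℝ) (n : ℕ) :
    bose n * spinState β n * bose n = spinState β n := by
  simp only [spinState, Matrix.mul_smul, Matrix.smul_mul, Matrix.mul_assoc, bose_mul_bose]
  simp only [← Matrix.mul_assoc, bose_mul_bose]

theorem spinState_apply_self (β : ℝ) (n : ℕ) (i : Cfg n) :
    spinState β n i i =
      (spinNorm β n * ((n.choose (ones i) : ℝ)⁻¹ * Real.exp (β * (n - 2 * ones i))) : ℝ) := by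
  rw [spinState_eq, tensorPow_torus, Matrix.smul_apply, Matrix.mul_diagonal, bose_apply, if_pos rfl,
    mag_eq]
  push_cast
  rfl

/-- The factors `sinh` cancel, leaving `dim K_{N,s}` and the normalization of the noisy state. -/
theorem weight_mul_spinNorm (N : ℕ) {β : ℝ} (hβ : 0 < β) (n : ℕ) :
    weight N β n * spinNorm β n = ((2 * Real.cosh β) ^ N)⁻¹ * multDim N n := by
  have h1 : Real.sinh β ≠ 0 := (Real.sinh_pos_iff.2 hβ).ne'
  have h2 : Real.sinh ((n + 1) * β) ≠ 0 := (Real.sinh_pos_iff.2 (by positivity)).ne'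
  have h3 := (Real.cosh_pos β).ne'
  rw [weight, spinNorm]
  field_simp

theorem fAll_eq (M : ℕ) (β : ℝ) (n : ℕ) :
    fAll M β n = ((cloner M n (Matrix.single 0 0 1) * spinState β n).trace).re := by
  rw [fAll, expect_traceDual, tensorPow_proj]

/-- On each isotypic component the noisy state `e^{2βL₃} / (2 cosh β)^N` compresses, by an
intertwiner, to a multiple of the spin state. -/
theorem fidelityAll_optPurifier_eq_sum (N M : ℕ) {β : ℝ} (hβ : 0 < β) :
    fidelityAll (Real.tanh β) (optPurifier N M) = ∑ n ∈ spins N, weight N β n * fAll M β n := by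
  rw [fidelityAll_optPurifier, depolarize_proj, tensorPow_smul, trace_optPurifier_mul,
    Complex.re_sum]
  refine Finset.sum_congr rfl fun n _ => ?_
  have hV : ∀ b, (toMap (stdOrthonormalBasis ℂ (multSpace N n) b).1)ᴴ *
      ((((2 * Real.cosh β : ℝ) : ℂ)⁻¹) ^ N • tensorPow N (torus β)) *
        toMap (stdOrthonormalBasis ℂ (multSpace N n) b).1 =
      ((((2 * Real.cosh β : ℝ) : ℂ)⁻¹) ^ N * ((n : ℂ) + 1)⁻¹) •
        (bose n * tensorPow n (torus β)) := by
    intro b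
    have hmem := (stdOrthonormalBasis ℂ (multSpace N n) b).2
    rw [Matrix.mul_smul, Matrix.smul_mul, Matrix.mul_assoc,
      ← intertwine_torus (hmem.2 _ torus_I_mem), ← Matrix.mul_assoc,
      conjTranspose_mul_self_of_mem_multSpace hmem
        ((stdOrthonormalBasis ℂ (multSpace N n)).orthonormal.1 b), Matrix.smul_mul, smul_smul]
  have hn : (n : ℂ) + 1 ≠ 0 := by exact_mod_cast n.succ_ne_zero
  simp_rw [hV]
  simp only [Matrix.mul_smul, Matrix.trace_smul, smul_eq_mul, Finset.sum_const,
    Finset.card_univ, Fintype.card_fin, nsmul_eq_mul]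
  rw [fAll_eq, spinState_eq, Matrix.mul_smul, Matrix.trace_smul, smul_eq_mul, Complex.re_ofReal_mul,
    ← mul_assoc (weight N β n), weight_mul_spinNorm N hβ, ← Complex.re_ofReal_mul, tensorPow_proj,
    multDim]
  congr 1
  push_cast
  rw [inv_pow]
  field_simp

/-! ### Component fidelities -/

theorem spinNorm_mul_exp {β : ℝ} (hβ : 0 < β) (n : ℕ) :
    spinNorm β n * Real.exp (n * β) =
      (1 - Real.exp (-2 * β)) / (1 - Real.exp (-(2 * (n : ℝ) + 2) * β)) := by
  have h2 : Real.sinh ((n + 1) * β) ≠ 0 := (Real.sinh_pos_iff.2 (by positivity)).ne'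
  have h3 : ∀ x, 1 - Real.exp (-2 * x) = 2 * Real.exp (-x) * Real.sinh x := by
    intro x
    rw [Real.sinh_eq]
    have h4 : Real.exp (-x) * Real.exp x = 1 := by rw [← Real.exp_add]; simp
    have h5 : Real.exp (-2 * x) = Real.exp (-x) * Real.exp (-x) := by
      rw [← Real.exp_add]; congr 1; ring
    rw [h5]
    linear_combination -h4
  have h6 : -(2 * (n : ℝ) + 2) * β = -2 * ((n + 1) * β) := by ring
  have h7 : Real.exp (-β) = Real.exp (n * β) * Real.exp (-((n + 1) * β)) := by
    rw [← Real.exp_add]; congr 1; ring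
  have h8 := (Real.exp_pos (-((n + 1) * β))).ne'
  rw [h6, h3, h3, h7, spinNorm]
  field_simp

/-- More output than input qubits: only the diagonal entry of the highest weight contributes. -/
theorem fAll_of_lt {M n : ℕ} {β : ℝ} (hβ : 0 < β) (h : n < M) :
    fAll M β n = ((n : ℝ) + 1) / ((M : ℝ) + 1) *
        ((1 - Real.exp (-2 * β)) / (1 - Real.exp (-(2 * (n : ℝ) + 2) * β))) := by
  rw [fAll_eq, cloner, dif_neg (not_le.2 h), trace_traceDual_mul, Matrix.trace_single_mul]
  simp only [clonerPredual, LinearMap.coe_mk, AddHom.coe_mk, Matrix.smul_apply,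
    bose_mul_spinState_mul_bose, bose_mul_mul_bose_zero]
  have h0 : tensorOne h.le (spinState β n) 0 0 = spinState β n 0 0 := by
    simp only [tensorOne, LinearMap.coe_mk, AddHom.coe_mk, Matrix.of_apply, implies_true, if_true]
    rfl
  rw [h0, spinState_apply_self, ones_zero, ← spinNorm_mul_exp hβ]
  have hc : ((n : ℂ) + 1) / ((M : ℂ) + 1) = (((n : ℝ) + 1) / ((M : ℝ) + 1) : ℝ) := by push_cast; rfl
  rw [hc, one_smul, smul_eq_mul, ← Complex.ofReal_mul, Complex.ofReal_re]
  simp [mul_comm]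

/-- The configurations of weight `w` with labels `0` on the first `M` qubits, as a fraction of all
configurations of weight `w`. -/
theorem choose_sub_mul_inv {M n K : ℕ} (hM : M ≤ n) (hK : K ≤ n) :
    ((n - M).choose (n - K) : ℝ) * (n.choose (n - K) : ℝ)⁻¹ =
      (n.choose M : ℝ)⁻¹ * (K.choose M : ℝ) := by
  rw [Nat.choose_symm hK]
  have h1 : (n.choose M : ℝ) ≠ 0 := Nat.cast_ne_zero.2 (Nat.choose_pos hM).ne'
  have h2 : (n.choose K : ℝ) ≠ 0 := Nat.cast_ne_zero.2 (Nat.choose_pos hK).ne'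
  field_simp
  rcases le_or_gt M K with h | h
  · have h3 : n.choose K * K.choose M = n.choose M * (n - M).choose (K - M) :=
      Nat.choose_mul h
    have h4 : (n - M).choose (n - K) = (n - M).choose (K - M) := by
      rw [← Nat.choose_symm (by omega : n - K ≤ n - M)]
      congr 1
      omega
    rw [h4]
    exact_mod_cast (by linarith [h3] : (n - M).choose (K - M) * n.choose M = n.choose K * K.choose M)
  -- For `K < M` both sides vanish.
  · rw [Nat.choose_eq_zero_of_lt (by omega : n - M < n - K), Nat.choose_eq_zero_of_lt h]
    simp

/-- At least as many input as output qubits: the diagonal of the spin state is summed over the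
configurations with labels `0` on the first `M` qubits. -/
theorem fAll_of_le {M n : ℕ} {β : ℝ} (hβ : 0 < β) (h : M ≤ n) :
    fAll M β n =
        (1 - Real.exp (-2 * β)) / (1 - Real.exp (-(2 * (n : ℝ) + 2) * β)) *
          ((n.choose M : ℝ))⁻¹ *
          ∑ K ∈ Finset.range (n + 1), (K.choose M : ℝ) * Real.exp (2 * β * ((K : ℝ) - n)) := by
  let s : Finset (Fin n) := {k | M ≤ (k : ℕ)}
  have hs : s.card = n - M := by
    change Finset.card {k : Fin n | M ≤ (k : ℕ)} = _
    have := Fin.card_filter_val_lt (n := n) (m := M)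
    have h2 := Finset.card_filter_add_card_filter_not (s := (Finset.univ : Finset (Fin n)))
      (fun k => (k : ℕ) < M)
    simp only [not_lt, Finset.card_univ, Fintype.card_fin] at h2
    omega
  have hE : tensorOne h (Matrix.single 0 0 1) =
      Matrix.diagonal fun i : Cfg n => if ∀ k ∉ s, i k = 0 then (1 : ℂ) else 0 := by
    have hzero : ∀ i : Cfg n, (0 = fun a => i (Fin.castLE h a)) ↔ ∀ k ∉ s, i k = 0 := by
      intro i
      rw [funext_iff]
      refine ⟨fun hi k hk => ?_, fun hi a => (hi _ (by simp [s])).symm⟩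
      have hk : (k : ℕ) < M := by simpa [s] using hk
      exact (hi ⟨k, hk⟩).symm
    ext i j
    simp only [tensorOne, LinearMap.coe_mk, AddHom.coe_mk, Matrix.of_apply, Matrix.single_apply,
      Matrix.diagonal_apply, hzero]
    by_cases hij : i = j
    · subst hij
      simp
    · rw [if_neg hij]
      split_ifs with h1 h2
      · refine absurd (funext fun k => ?_) hij
        by_cases hk : M ≤ (k : ℕ)
        · exact h1 k hk
        · have hks : k ∉ s := by simpa [s] using hk
          rw [h2.1 k hks, h2.2 k hks]
      · rfl
      · rfl
  have htr : (cloner M n (Matrix.single 0 0 1) * spinState β n).trace =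
      ∑ i : Cfg n, if ∀ k ∉ s, i k = 0 then
        ((spinNorm β n * ((n.choose (ones i) : ℝ)⁻¹ * Real.exp (β * (n - 2 * ones i))) : ℝ) : ℂ)
      else 0 := by
    rw [cloner, dif_pos h]
    simp only [discard, LinearMap.coe_mk, AddHom.coe_mk]
    have hcyc : (bose n * tensorOne h (Matrix.single 0 0 1) * bose n * spinState β n).trace =
        (tensorOne h (Matrix.single 0 0 1) * (bose n * spinState β n * bose n)).trace := by
      rw [Matrix.mul_assoc, Matrix.mul_assoc, Matrix.trace_mul_comm, Matrix.mul_assoc]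
    rw [hcyc, bose_mul_spinState_mul_bose, hE]
    simp only [Matrix.trace, Matrix.diag_apply, Matrix.diagonal_mul, spinState_apply_self, ite_mul,
      one_mul, zero_mul]
  rw [fAll_eq, htr, sum_ones (fun w =>
    ((spinNorm β n * ((n.choose w : ℝ)⁻¹ * Real.exp (β * (n - 2 * w))) : ℝ) : ℂ)),
    ← spinNorm_mul_exp hβ, Complex.re_sum, ← Finset.sum_range_reflect, Finset.mul_sum]
  -- The summation index `K` is the number of labels `0`, so the weight is `n - K`.
  refine Finset.sum_congr rfl fun K hK => ?_
  have hK : K ≤ n := Nat.lt_succ_iff.1 (Finset.mem_range.1 hK)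
  rw [card_ones_eq, hs, ← Complex.ofReal_natCast, ← Complex.ofReal_mul, Complex.ofReal_re,
    Nat.add_sub_cancel]
  have he : Real.exp (β * (n - 2 * ((n - K : ℕ) : ℝ))) =
      Real.exp (n * β) * Real.exp (2 * β * (K - n)) := by
    rw [← Real.exp_add, Nat.cast_sub hK]
    congr 1
    ring
  rw [he]
  linear_combination (spinNorm β n * Real.exp (n * β) * Real.exp (2 * β * (K - n))) *
    choose_sub_mul_inv h hK

end Purification

end

theorem mainTheorem5 (N M : ℕ) (β : ℝ) (hβ : 0 < β) :
    fidelityAll (Real.tanh β) (optPurifier N M) = ∑ n ∈ spins N, weight N β n * fAll M β n ∧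
    (∀ n : ℕ, n < M →
      fAll M β n = ((n : ℝ) + 1) / ((M : ℝ) + 1) *
        ((1 - Real.exp (-2 * β)) / (1 - Real.exp (-(2 * (n : ℝ) + 2) * β)))) ∧
    (∀ n : ℕ, M ≤ n →
      fAll M β n =
        (1 - Real.exp (-2 * β)) / (1 - Real.exp (-(2 * (n : ℝ) + 2) * β)) *
          ((n.choose M : ℝ))⁻¹ *
          ∑ K ∈ Finset.range (n + 1), (K.choose M : ℝ) * Real.exp (2 * β * ((K : ℝ) - n))) := by
  exact ⟨fidelityAll_optPurifier_eq_sum N M hβ, fun _ h => fAll_of_lt hβ h,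
    fun _ h => fAll_of_le hβ h⟩
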